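/- **Theorem.** Let $n,m\in\mathbb N$, let $T\in\mathbb R$, $x_0,x_T\in\mathbb R^n$, let $X\subset\mathbb R^n$ be compact and put $K:=[0,T]\times X$. For $j=1,\dots,m$ let $f_j:K\to\mathbb R^n$ and $l_j:K\to\mathbb R$ be continuous, and Lipschitz continuous with respect to the state variable $x$, uniformly in $t$. Let $\mathcal C^1(K)$ denote the continuously differentiable functions $v(t,x)$ on $\mathbb R\times\mathbb R^n$, considered together with their first derivatives on $K$, and let $\mathcal M^+(K)$ be the cone of finite nonnegative Borel measures on $K$. Consider the measure LP $$p^*=\inf_{(\mu_1,\dots,\mu_m)\in\mathcal M^+(K)^m}\ \sum_{j=1}^m\int_K l_j\,d\mu_j\quad\text{s.t.}\quad v(T,x_T)-v(0,x_0)=\sum_{j=1}^m\int_K\Big(\frac{\partial v}{\partial t}+\frac{\partial v}{\partial x}\cdot f_j\Big)d\mu_j\quad\text{for all } v\in\mathcal C^1(K),$$ and the dual LP $$d^*=\sup_{v\in\mathcal C^1(K)}\ v(T,x_T)-v(0,x_0)\quad\text{s.t.}\quad l_j-\frac{\partial v}{\partial t}-\frac{\partial v}{\partial x}\cdot f_j\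 \ge\ 0\ \text{ on }K,\quad j=1,\dots,m,$$ with values taken in $[-\infty,+\infty]$. If there is an admissible vector $(\mu_1,\dots,\mu_m)$ for the measure LP, then $$p^*=d^*.$$ -/

import Mathlib

open MeasureTheory

noncomputable section

namespace SwitchedLP

/-- The state space `ℝⁿ`. -/
abbrev State (n : ℕ) : Type := EuclideanSpace ℝ (Fin n)

/-- The set `K = [0, T] × X` of admissible times and states. -/
abbrev timeState {n : ℕ} (T : ℝ) (X : Set (State n)) : Set (ℝ × State n) :=
  Set.Icc (0 : ℝ) T ×ˢ X

/-- A function on `K = [0, T] × X` is Lipschitz with respect to the state variable, uniformly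
in time. -/
def LipschitzInState {n : ℕ} {T : ℝ} {X : Set (State n)} {F : Type*} [PseudoMetricSpace F]
    (g : timeState T X → F) : Prop :=
  ∃ L : ℝ, ∀ p q : timeState T X, p.1.1 = q.1.1 → dist (g p) (g q) ≤ L * dist p.1.2 q.1.2

/-- The data of the switched optimal control problem with `m` modes: terminal time, initial and
terminal states, compact state constraint set, dynamics and Lagrangians, the latter two being
continuous on `K = [0, T] × X` and Lipschitz with respect to the state. -/
structure Data (n m : ℕ) where
  T : ℝ
  x₀ : State n
  xT : State n
  X : Set (State n)
  isCompact_X : IsCompact X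
  f : Fin m → timeState T X → State n
  l : Fin m → timeState T X → ℝ
  continuous_f : ∀ j, Continuous (f j)
  continuous_l : ∀ j, Continuous (l j)
  lipschitz_f : ∀ j, LipschitzInState (f j)
  lipschitz_l : ∀ j, LipschitzInState (l j)

variable {n m : ℕ}

/-- The set `K = [0, T] × X` of the problem. -/
abbrev Data.K (D : Data n m) : Set (ℝ × State n) := timeState D.T D.X

/-- Continuously differentiable test functions on `K`: since `K` is an arbitrary compact set,
these are given, together with their derivatives on `K`, by the continuously differentiable
functions on `ℝ × ℝⁿ`. -/
def IsTest (v : ℝ × State n → ℝ) : Prop := ContDiff ℝ 1 v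

/-- The operator `L'ⱼ v = ∂v/∂t + ∂v/∂x · fⱼ`, a function on `K`. -/
def Data.adjointOp (D : Data n m) (j : Fin m) (v : ℝ × State n → ℝ) (p : D.K) : ℝ :=
  fderiv ℝ v p.1 (1, 0) + fderiv ℝ v p.1 (0, D.f j p)

/-- `v(T, x_T) - v(0, x₀)`. -/
def Data.boundary (D : Data n m) (v : ℝ × State n → ℝ) : ℝ :=
  v (D.T, D.xT) - v (0, D.x₀)

/-- Admissible vectors of the measure LP: `m` finite nonnegative Borel measures on `K`
satisfying the weak dynamics. -/
def Data.PrimalAdmissible (D : Data n m) (μ : Fin m → FiniteMeasure D.K) : Prop :=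
  ∀ v : ℝ × State n → ℝ, IsTest v →
    D.boundary v = ∑ j, ∫ p, D.adjointOp j v p ∂(μ j : Measure D.K)

/-- The cost `∑ⱼ ⟨lⱼ, μⱼ⟩`. -/
def Data.cost (D : Data n m) (μ : Fin m → FiniteMeasure D.K) : ℝ :=
  ∑ j, ∫ p, D.l j p ∂(μ j : Measure D.K)

/-- The value `p*` of the measure LP, an infimum in the extended reals. -/
def Data.primalValue (D : Data n m) : EReal :=
  sInf {r : EReal | ∃ μ : Fin m → FiniteMeasure D.K, D.PrimalAdmissible μ ∧ r = (D.cost μ : EReal)}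

/-- Admissible functions of the dual LP: the Hamilton-Jacobi-Bellman inequalities hold on `K`
for every mode. -/
def Data.DualAdmissible (D : Data n m) (v : ℝ × State n → ℝ) : Prop :=
  IsTest v ∧ ∀ (j : Fin m) (p : D.K), 0 ≤ D.l j p - D.adjointOp j v p

/-- The value `d*` of the dual LP, a supremum in the extended reals. -/
def Data.dualValue (D : Data n m) : EReal :=
  sSup {r : EReal | ∃ v : ℝ × State n → ℝ, D.DualAdmissible v ∧ r = (D.boundary v : EReal)}

end SwitchedLP

end

namespace SwitchedLP

/-! Weak duality is integration of the dual inequalities. For the converse, let `d` be the supremum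
of the dual and prescribe `A v + c • l ↦ b v + c * d`. Primal feasibility and the definition of `d`
make this nonnegative wherever `A v + c • l` lies in the cone, and M. Riesz's theorem extends it to
a positive functional on `C(K)^m`. The Slater condition it needs comes from `v = c t`, which every
mode maps to the constant `c`. Riesz–Markov turns the components into measures: they are admissible
and cost exactly `d`. -/

/-- Strong duality for conic linear programs under a Slater-type condition: the dual value `d` is
attained by a functional nonnegative on the cone. -/
theorem exists_functional_of_isLUB {V W : Type*} [AddCommGroup V] [Module ℝ V] [AddCommGroup W]
    [Module ℝ W] (s : PointedCone ℝ W) (A : V →ₗ[ℝ] W) (b : V →ₗ[ℝ] ℝ) (l : W) (d : ℝ)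
    (hb : ∀ v, A v ∈ s → 0 ≤ b v) (hd : IsLUB (b '' {v | l - A v ∈ s}) d)
    (dense : ∀ w, ∃ v, A v + w ∈ s) :
    ∃ g : W →ₗ[ℝ] ℝ, (∀ w ∈ s, 0 ≤ g w) ∧ (∀ v, g (A v) = b v) ∧ g l = d := by
  -- Working upstairs on `W × V × ℝ` with the pulled-back cone avoids checking that the prescription
  -- is well defined on the span of `l` and the range of `A`.
  let M : W × V × ℝ →ₗ[ℝ] W :=
    LinearMap.coprod LinearMap.id (LinearMap.coprod A (LinearMap.toSpanSingleton ℝ W l))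
  have hM : ∀ w v c, M (w, v, c) = w + (A v + c • l) := fun w v c => by
    simp [M, LinearMap.coprod_apply]
  let β : W × V × ℝ →ₗ[ℝ] ℝ :=
    LinearMap.coprod 0 (LinearMap.coprod b (LinearMap.toSpanSingleton ℝ ℝ d))
  have hβ : ∀ w v c, β (w, v, c) = b v + c * d := fun w v c => by
    simp [β, LinearMap.coprod_apply]
  let dom : Submodule ℝ (W × V × ℝ) := LinearMap.ker (LinearMap.fst ℝ W (V × ℝ))
  have hdom : ∀ v c, ((0 : W), (v : V), (c : ℝ)) ∈ dom := fun v c => by simp [dom]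
  obtain ⟨w₀, hw₀⟩ : ∃ v, l - A v ∈ s := by
    obtain ⟨v, hv⟩ := dense l
    exact ⟨-v, by simpa [add_comm] using hv⟩
  have hnonneg : ∀ v c, A v + c • l ∈ s → 0 ≤ b v + c * d := by
    intro v c h
    rcases lt_trichotomy c 0 with hc | rfl | hc
    -- Adding `-c` times the slack of `w` cancels `l`, so `hb` bounds every dual value by the same
    -- number, hence also `d`.
    · have h1 : ∀ w, l - A w ∈ s → b w ≤ -(c⁻¹ * b v) := by
        intro w hw
        have h2 := s.add_mem (s.smul_mem (show 0 ≤ -c from by linarith) hw) h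
        have h3 : (-c) • (l - A w) + (A v + c • l) = A (c • w + v) := by
          simp only [map_add, map_smul]; module
        rw [h3] at h2
        have h4 := hb _ h2
        simp only [map_add, map_smul, smul_eq_mul] at h4
        have : 0 ≤ (-c)⁻¹ * (c * b w + b v) :=
          mul_nonneg (inv_nonneg.2 (by linarith)) h4
        have e : (-c)⁻¹ * (c * b w + b v) = -b w + -(c⁻¹ * b v) := by
          field_simp [hc.ne]
          ring
        linarith
      have h5 : d ≤ -(c⁻¹ * b v) := hd.2 (by rintro _ ⟨w, hw, rfl⟩; exact h1 w hw)
      have h6 := mul_le_mul_of_nonneg_left h5 (show 0 ≤ -c by linarith)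
      have e : -c * -(c⁻¹ * b v) = b v := by field_simp [hc.ne]
      linarith
    · simpa using hb v (by simpa using h)
    -- Rescaling makes `-c⁻¹ • v` dual feasible, so its value is at most `d`.
    · have h1 : l - A (-(c⁻¹ • v)) ∈ s := by
        have := s.smul_mem (inv_nonneg.2 hc.le) h
        convert this using 1
        simp only [map_neg, map_smul, smul_add, smul_smul, inv_mul_cancel₀ hc.ne', one_smul]
        abel
      have h2 := hd.1 ⟨_, h1, rfl⟩
      simp only [map_neg, map_smul, smul_eq_mul] at h2
      have h6 := mul_le_mul_of_nonneg_left h2 hc.le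
      have e : c * -(c⁻¹ * b v) = -b v := by field_simp [hc.ne']
      linarith
  obtain ⟨g, hg, hgs⟩ := riesz_extension (s.comap M) ⟨dom, β.domRestrict dom⟩
    (by
      rintro ⟨⟨w, v, c⟩, hw⟩ hx
      obtain rfl : w = 0 := by simpa [dom] using hw
      have hx' : M (0, v, c) ∈ s := hx
      rw [hM, zero_add] at hx'
      change 0 ≤ β (0, v, c)
      rw [hβ]
      exact hnonneg v c hx')
    (by
      rintro ⟨w, v, c⟩
      obtain ⟨u, hu⟩ := dense (w + (A v + c • l))
      refine ⟨⟨(0, u, 0), hdom u 0⟩, ?_⟩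
      change M ((0, u, 0) + (w, v, c)) ∈ s
      rw [map_add, hM, hM]
      simpa using hu)
  have hg0 : ∀ v c, g (0, v, c) = b v + c * d := fun v c => by
    rw [← hβ 0]; exact hg ⟨(0, v, c), hdom v c⟩
  have hker : ∀ v c, g (A v + c • l, 0, 0) = b v + c * d := by
    intro v c
    -- The pulled-back cone contains `ker M` with both signs, so `g` vanishes there and descends to
    -- `W`.
    have h1 : ∀ x, M x = 0 → g x = 0 := fun x hx => by
      have p := hgs x (show M x ∈ s by rw [hx]; exact s.zero_mem)
      have q := hgs (-x) (show M (-x) ∈ s by rw [map_neg, hx, neg_zero]; exact s.zero_mem)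
      rw [map_neg] at q
      linarith
    have h2 := h1 ((A v + c • l, 0, 0) - (0, v, c)) (by rw [map_sub, hM, hM]; simp)
    rw [map_sub, hg0] at h2
    linarith
  refine ⟨g.comp (LinearMap.inl ℝ W (V × ℝ)), fun w hw => hgs (w, 0, 0) ?_, fun v => ?_, ?_⟩
  · change M (w, 0, 0) ∈ s
    rw [hM]; simpa using hw
  · change g (A v, 0, 0) = b v
    simpa using hker v 0
  · change g (l, 0, 0) = d
    simpa using hker 0 1

/-- Positive linear functionals on `C(Y, ℝ)`, with `Y` compact Hausdorff, are integrals against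
finite measures. -/
theorem exists_finiteMeasure_integral_eq {Y : Type*} [TopologicalSpace Y] [T2Space Y]
    [CompactSpace Y] [MeasurableSpace Y] [BorelSpace Y] (Λ : C(Y, ℝ) →ₗ[ℝ] ℝ)
    (hΛ : ∀ h, 0 ≤ h → 0 ≤ Λ h) :
    ∃ μ : FiniteMeasure Y, ∀ h : C(Y, ℝ), ∫ y, h y ∂(μ : Measure Y) = Λ h := by
  let L : CompactlySupportedContinuousMap Y ℝ →ₗ[ℝ] ℝ :=
    { toFun := fun h => Λ h.toContinuousMap
      map_add' := fun h k => Λ.map_add h.toContinuousMap k.toContinuousMap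
      map_smul' := fun c h => Λ.map_smul c h.toContinuousMap }
  let P : CompactlySupportedContinuousMap Y ℝ →ₚ[ℝ] ℝ :=
    PositiveLinearMap.mk₀ L fun h hh => hΛ _ fun y => hh y
  refine ⟨⟨RealRMK.rieszMeasure P, inferInstance⟩, fun h => ?_⟩
  exact RealRMK.integral_rieszMeasure P (CompactlySupportedContinuousMap.continuousMapEquiv h)

variable {n m : ℕ} (D : Data n m)

instance : CompactSpace D.K :=
  isCompact_iff_compactSpace.1 (isCompact_Icc.prod D.isCompact_X)

/-- The vector space of test functions. -/
def testSpace (n : ℕ) : Submodule ℝ (ℝ × State n → ℝ) where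
  carrier := {v | IsTest v}
  add_mem' {u v} (hu : ContDiff ℝ 1 u) (hv : ContDiff ℝ 1 v) :=
    show ContDiff ℝ 1 (u + v) from hu.add hv
  zero_mem' := show ContDiff ℝ 1 (fun _ => (0 : ℝ)) from contDiff_const
  smul_mem' c v (hv : ContDiff ℝ 1 v) := show ContDiff ℝ 1 (c • v) from hv.const_smul c

theorem IsTest.differentiable {v : ℝ × State n → ℝ} (hv : IsTest v) : Differentiable ℝ v :=
  ContDiff.differentiable hv one_ne_zero

theorem IsTest.continuous_adjointOp {v : ℝ × State n → ℝ} (hv : IsTest v) (j : Fin m) :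
    Continuous (D.adjointOp j v) := by
  have h : Continuous (fderiv ℝ v) := ContDiff.continuous_fderiv hv one_ne_zero
  have hf := D.continuous_f j
  unfold Data.adjointOp
  fun_prop

/-- The operator `v ↦ (L'₁ v, …, L'ₘ v)` from test functions to continuous functions. -/
noncomputable def Data.adjointMap : testSpace n →ₗ[ℝ] (Fin m → C(D.K, ℝ)) where
  toFun v j := ⟨D.adjointOp j v, IsTest.continuous_adjointOp D v.2 j⟩
  map_add' u v := by
    ext j p
    simp only [Data.adjointOp, Submodule.coe_add, ContinuousMap.coe_mk, Pi.add_apply,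
      ContinuousMap.add_apply,
      fderiv_add (IsTest.differentiable u.2 _) (IsTest.differentiable v.2 _),
      _root_.add_apply]
    ring
  map_smul' c v := by
    ext j p
    simp only [Data.adjointOp, Submodule.coe_smul, ContinuousMap.coe_mk, Pi.smul_apply,
      ContinuousMap.smul_apply, fderiv_const_smul (IsTest.differentiable v.2 _),
      _root_.smul_apply, RingHom.id_apply, smul_eq_mul]
    ring

theorem Data.adjointMap_apply (v : testSpace n) (j : Fin m) (p : D.K) :
    D.adjointMap v j p = D.adjointOp j v p := rfl

/-- The objective `v ↦ v(T, x_T) - v(0, x₀)` as a linear functional. -/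
def Data.boundaryMap : testSpace n →ₗ[ℝ] ℝ where
  toFun v := D.boundary v
  map_add' u v := by simp [Data.boundary]; ring
  map_smul' c v := by simp [Data.boundary]; ring

/-- The Lagrangians as continuous functions. -/
def Data.lagrangian (j : Fin m) : C(D.K, ℝ) := ⟨D.l j, D.continuous_l j⟩

theorem adjointOp_const_mul_fst (c : ℝ) (j : Fin m) (p : D.K) :
    D.adjointOp j (fun q => c * q.1) p = c := by
  have h : HasFDerivAt (fun q : ℝ × State n => c * q.1)
      (c • ContinuousLinearMap.fst ℝ ℝ (State n)) p.1 := hasFDerivAt_fst.const_mul c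
  simp [Data.adjointOp, h.fderiv]

/-- Slater condition: a steep enough function of time alone dominates any `w`, since the dynamics do
not enter its image. -/
theorem exists_adjointMap_add_nonneg (w : Fin m → C(D.K, ℝ)) :
    ∃ v, 0 ≤ D.adjointMap v + w := by
  have hv : ContDiff ℝ 1 (fun q : ℝ × State n => (∑ j, ‖w j‖) * q.1) :=
    contDiff_const.mul contDiff_fst
  refine ⟨⟨fun q => (∑ j, ‖w j‖) * q.1, hv⟩, fun j p => ?_⟩
  change 0 ≤ D.adjointOp j (fun q => (∑ j, ‖w j‖) * q.1) p + w j p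
  rw [adjointOp_const_mul_fst]
  have h1 := Finset.single_le_sum (fun i _ => norm_nonneg (w i)) (Finset.mem_univ j)
  have h2 := (abs_le.1 ((w j).norm_coe_le_norm p)).1
  linarith

theorem integrable_of_continuous {Y : Type*} [TopologicalSpace Y] [CompactSpace Y]
    [MeasurableSpace Y] [BorelSpace Y] (μ : FiniteMeasure Y) {h : Y → ℝ} (hh : Continuous h) :
    Integrable h (μ : Measure Y) :=
  BoundedContinuousFunction.integrable _ (BoundedContinuousFunction.mkOfCompact ⟨h, hh⟩)

/-- Weak duality. -/
theorem boundary_le_cost {μ : Fin m → FiniteMeasure D.K} (hμ : D.PrimalAdmissible μ)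
    {v : ℝ × State n → ℝ} (hv : D.DualAdmissible v) : D.boundary v ≤ D.cost μ := by
  rw [hμ v hv.1, Data.cost]
  refine Finset.sum_le_sum fun j _ => integral_mono
    (integrable_of_continuous _ (hv.1.continuous_adjointOp D j))
    (integrable_of_continuous _ (D.continuous_l j)) fun p => sub_nonneg.1 (hv.2 j p)

/-- The measure LP attains the value of the dual LP. -/
theorem exists_primalAdmissible_cost_eq {d : ℝ}
    (hfeas : ∃ μ : Fin m → FiniteMeasure D.K, D.PrimalAdmissible μ)
    (hd : IsLUB (D.boundary '' {v | D.DualAdmissible v}) d) :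
    ∃ μ, D.PrimalAdmissible μ ∧ D.cost μ = d := by
  obtain ⟨ν, hν⟩ := hfeas
  have hset : D.boundaryMap '' {v | D.lagrangian - D.adjointMap v ∈
      PointedCone.positive ℝ (Fin m → C(D.K, ℝ))} = D.boundary '' {v | D.DualAdmissible v} := by
    ext r
    constructor
    · rintro ⟨v, hv, rfl⟩
      exact ⟨v, ⟨v.2, fun j p => hv j p⟩, rfl⟩
    · rintro ⟨v, hv, rfl⟩
      exact ⟨⟨v, hv.1⟩, fun j p => hv.2 j p, rfl⟩
  obtain ⟨g, hg, hgA, hgl⟩ := exists_functional_of_isLUB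
    (PointedCone.positive ℝ (Fin m → C(D.K, ℝ))) D.adjointMap D.boundaryMap D.lagrangian d
    -- Integrating against the feasible `ν` gives the sign of `b`.
    (fun v hv => by
      change 0 ≤ D.boundary v
      rw [hν v v.2]
      exact Finset.sum_nonneg fun j _ => integral_nonneg fun p => hv j p)
    (hset ▸ hd) (exists_adjointMap_add_nonneg D)
  choose μ hμ using fun j => exists_finiteMeasure_integral_eq
    (g.comp (LinearMap.single ℝ (fun _ : Fin m => C(D.K, ℝ)) j))
    (fun h hh => hg _ (by
      change (0 : Fin m → C(D.K, ℝ)) ≤ Pi.single (M := fun _ => C(D.K, ℝ)) j h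
      exact Pi.single_nonneg.2 hh))
  have hsum : ∀ h : Fin m → C(D.K, ℝ), ∑ j, ∫ p, h j p ∂(μ j : Measure D.K) = g h := by
    intro h
    conv_rhs => rw [← Finset.univ_sum_single h, map_sum]
    exact Finset.sum_congr rfl fun j _ => hμ j (h j)
  exact ⟨μ, fun v hv => ((hsum _).trans (hgA ⟨v, hv⟩)).symm, (hsum D.lagrangian).trans hgl⟩

end SwitchedLP

theorem mainTheorem2 (n m : ℕ) (D : SwitchedLP.Data n m)
    (hfeas : ∃ μ : Fin m → MeasureTheory.FiniteMeasure D.K, D.PrimalAdmissible μ) :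
    D.primalValue = D.dualValue := by
  apply le_antisymm
  · obtain ⟨ν, hν⟩ := id hfeas
    obtain ⟨v, hv⟩ := SwitchedLP.exists_adjointMap_add_nonneg D D.lagrangian
    have hv' : D.DualAdmissible (-v : SwitchedLP.testSpace n) := by
      refine ⟨(-v).2, fun j p => ?_⟩
      have h : 0 ≤ D.adjointMap v j p + D.l j p := hv j p
      have e : D.adjointMap (-v) j p = -D.adjointMap v j p := by rw [map_neg]; rfl
      rw [← D.adjointMap_apply, e]
      linarith
    have hd := isLUB_csSup (s := D.boundary '' {v | D.DualAdmissible v})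
      (Set.Nonempty.image _ ⟨_, hv'⟩)
      ⟨D.cost ν, by rintro _ ⟨w, hw, rfl⟩; exact SwitchedLP.boundary_le_cost D hν hw⟩
    obtain ⟨μ, hμ, hc⟩ := SwitchedLP.exists_primalAdmissible_cost_eq D hfeas hd
    refine (show D.primalValue ≤ _ from sInf_le ⟨μ, hμ, rfl⟩).trans ?_
    rw [hc]
    -- Compares the real supremum with the one in `EReal`; the case `⊥` uses that a dual admissible
    -- function exists.
    refine le_of_forall_lt fun c hcd => ?_
    induction c with
    | bot =>
      exact (EReal.bot_lt_coe _).trans_le (le_sSup ⟨_, hv', rfl⟩)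
    | top => exact absurd hcd (not_lt.2 le_top)
    | coe c =>
      obtain ⟨_, ⟨w, hw, rfl⟩, hlt⟩ := (lt_isLUB_iff hd).1 (EReal.coe_lt_coe_iff.1 hcd)
      exact (EReal.coe_lt_coe_iff.2 hlt).trans_le (le_sSup ⟨w, hw, rfl⟩)
  · refine sSup_le ?_
    rintro _ ⟨v, hv, rfl⟩
    refine le_sInf ?_
    rintro _ ⟨μ, hμ, rfl⟩
    exact EReal.coe_le_coe_iff.2 (SwitchedLP.boundary_le_cost D hμ hv)
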